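/- For a number field $K$ let $\mathcal{O}_K$ be its ring of integers and $h(K)$ its class number. For a prime $\mathfrak{q}$ of $K$ (a prime ideal of $\mathcal{O}_K$) dividing a rational prime $q$, let $f(\mathfrak{q}|q)$ be its residual degree and $e(\mathfrak{q}|q)$ its ramification index. For a totally real number field $K$ and an odd prime $q$ put $$S_q=\{\mathfrak{q} : \mathfrak{q}\text{ is a prime of }K\text{ dividing }q\},\qquad T_q=\{\mathfrak{q}\in S_q : f(\mathfrak{q}|q)=1\},\qquad V_q=\{\mathfrak{q}\in S_q : 2\nmid e(\mathfrak{q}|q)\}.$$ We say that $K$ satisfies Assumption 1.1 if 1. $T_3\neq\emptyset$, 2. $V_3\neq\emptyset$, and 3. $h(K(\sqrt{-3}))$ is odd. **Corollary 4.2.** There is no totally real quadratic extension $K$ of $\mathbb{Q}$ that satisfies Assumption 1.1. -/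

import Mathlib

open NumberField

noncomputable section

/-- `K(√-3)`, the subfield of an algebraic closure of `K` generated over `K` by the square roots
of `-3`. -/
abbrev AdjoinSqrtNegThree (K : Type*) [Field K] : IntermediateField K (AlgebraicClosure K) :=
  IntermediateField.adjoin K {s : AlgebraicClosure K | s ^ 2 = -3}

instance AdjoinSqrtNegThree.finiteDimensional (K : Type*) [Field K] :
    FiniteDimensional K (AdjoinSqrtNegThree K) := by
  have : Finite {s : AlgebraicClosure K | s ^ 2 = -3} := by
    refine Set.Finite.subset
      (Polynomial.nthRootsFinset 2 (-3 : AlgebraicClosure K)).finite_toSet ?_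
    intro s hs
    simpa [Polynomial.mem_nthRootsFinset] using hs
  exact IntermediateField.finiteDimensional_adjoin
    fun x _ => Algebra.IsIntegral.isIntegral x

instance AdjoinSqrtNegThree.numberField (K : Type*) [Field K] [NumberField K] :
    NumberField (AdjoinSqrtNegThree K) :=
  NumberField.of_module_finite K (AdjoinSqrtNegThree K)

/-- `S_q`: the primes of `K` dividing the rational prime `q`. -/
def primesAbove (K : Type*) [Field K] (q : ℕ) : Set (Ideal (𝓞 K)) :=
  Ideal.primesOver (Ideal.span {(q : ℤ)}) (𝓞 K)

/-- `T_q`: the primes of `K` above `q` of residual degree `1`. -/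
def degreeOnePrimesAbove (K : Type*) [Field K] (q : ℕ) : Set (Ideal (𝓞 K)) :=
  {P ∈ primesAbove K q | P.inertiaDeg ℤ = 1}

/-- `V_q`: the primes of `K` above `q` of odd ramification index. -/
def oddRamifiedPrimesAbove (K : Type*) [Field K] (q : ℕ) : Set (Ideal (𝓞 K)) :=
  {P ∈ primesAbove K q | ¬ 2 ∣ P.ramificationIdx ℤ}

/-- The assumption on a number field `K`: there is a prime above `3` of residual degree `1`, there
is a prime above `3` of odd ramification index, and the class number of `K(√-3)` is odd. -/
structure SatisfiesAssumption (K : Type*) [Field K] [NumberField K] : Prop where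
  degreeOne_nonempty : (degreeOnePrimesAbove K 3).Nonempty
  oddRamified_nonempty : (oddRamifiedPrimesAbove K 3).Nonempty
  odd_classNumber : Odd (classNumber (AdjoinSqrtNegThree K))

end

/-! A real quadratic field is `ℚ(√d)` with `d > 1` squarefree. A degree-one prime above 3 rules out
`d ≡ 2 (mod 3)`, and a prime above 3 with odd ramification index rules out `3 ∣ d`. So `d ≡ 1 (mod
3)`, and it suffices to show that `L = ℚ(√d, √-3)` has even class number
(`BiquadraticData.not_odd_classNumber`).

Suppose the class number of `L` is odd. Then every element generating the square of an ideal is a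
unit times a square (`isUnitMulSq_of_span_eq_sq`). Since `L` is totally complex of degree 4, its
units modulo squares have dimension at most 2 over the field with two elements, so any three such
elements satisfy a nontrivial relation modulo squares (`exists_prod_eq_sq`). The contradiction comes
from `-1` and two further elements that are independent modulo squares. The available elements are:
a proper prime divisor of `d`, or 2 when `d ≡ 3 (mod 4)`; a factor `π = x + y√-3` of a prime `p ∣ d`
with `p ≡ 1 (mod 3)`; a unit `e` of norm `-1` over `ℚ(√-3)`, which exists when `d` is a sum of two
squares there (`exists_unit_mul_eq_neg_one`). Every factorization of `d` supplies two of these. -/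

/-! ### Primes represented by binary quadratic forms. -/

/-- Thue's lemma. -/
theorem exists_small_of_prime {p : ℕ} (hp : p.Prime) (a : ℤ) :
    ∃ x y : ℤ, (x ≠ 0 ∨ y ≠ 0) ∧ (p : ℤ) ∣ x - a * y ∧ x ^ 2 < p ∧ y ^ 2 < p := by
  have : NeZero p := ⟨hp.ne_zero⟩
  set k := Nat.sqrt p with hk
  have hlt : p < (k + 1) * (k + 1) := Nat.lt_succ_sqrt p
  have hle : k * k ≤ p := Nat.sqrt_le p
  have hne : k * k ≠ p := fun h => hp.not_isSquare ⟨k, h.symm⟩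
  have hkp : (k : ℤ) * k < p := by exact_mod_cast lt_of_le_of_ne hle hne
  have bound : ∀ i j : Fin (k + 1), ((i : ℤ) - j) ^ 2 < p := by
    intro i j
    have hi : (i : ℤ) ≤ k := by have := i.2; omega
    have hj : (j : ℤ) ≤ k := by have := j.2; omega
    have hi0 : (0 : ℤ) ≤ i := by positivity
    have hj0 : (0 : ℤ) ≤ j := by positivity
    nlinarith [abs_le_of_sq_le_sq' (a := (i : ℤ) - j) (b := k)]
  -- Pigeonhole: there are `(k + 1) ^ 2 > p` pairs and only `p` residues `u.1 - a * u.2`.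
  obtain ⟨u, v, huv, hf⟩ := Fintype.exists_ne_map_eq_of_card_lt
    (fun u : Fin (k + 1) × Fin (k + 1) => (((u.1 : ℤ) - a * (u.2 : ℤ) : ℤ) : ZMod p))
    (by simpa using hlt)
  refine ⟨(u.1 : ℤ) - v.1, (u.2 : ℤ) - v.2, ?_, ?_, bound _ _, bound _ _⟩
  · by_contra! h
    apply huv
    ext
    · have := h.1; omega
    · have := h.2; omega
  · have := (ZMod.intCast_eq_intCast_iff_dvd_sub _ _ p).1 hf.symm
    convert this using 1
    ring

theorem exists_small_sq_sub_mul_sq {p : ℕ} (hp : p.Prime) {c : ℤ}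
    (hc : IsSquare (c : ZMod p)) :
    ∃ x y : ℤ, (x ≠ 0 ∨ y ≠ 0) ∧ (p : ℤ) ∣ x ^ 2 - c * y ^ 2 ∧ x ^ 2 < p ∧ y ^ 2 < p := by
  obtain ⟨t, ht⟩ := hc
  obtain ⟨a, rfl⟩ := ZMod.intCast_surjective t
  have ha : (p : ℤ) ∣ a * a - c := by
    apply (ZMod.intCast_eq_intCast_iff_dvd_sub _ _ p).1
    push_cast
    exact ht
  obtain ⟨x, y, h0, hd, hx, hy⟩ := exists_small_of_prime hp a
  refine ⟨x, y, h0, ?_, hx, hy⟩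
  have : x ^ 2 - c * y ^ 2 = (x - a * y) * (x + a * y) + (a * a - c) * y ^ 2 := by ring
  rw [this]
  exact dvd_add (hd.mul_right _) (ha.mul_right _)

theorem isSquare_neg_three_of_mod_three_eq_one {p : ℕ} (hp : p.Prime) (h : p % 3 = 1) :
    IsSquare (-3 : ZMod p) := by
  have : Fact p.Prime := ⟨hp⟩
  have hdvd : 3 ∣ Fintype.card (ZMod p)ˣ := by
    rw [ZMod.card_units]; omega
  have : Fact (Nat.Prime 3) := ⟨Nat.prime_three⟩
  obtain ⟨u, hu⟩ := exists_prime_orderOf_dvd_card 3 hdvd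
  have h1 : (u : ZMod p) ^ 3 = 1 := by
    have : u ^ 3 = 1 := hu ▸ pow_orderOf_eq_one u
    simpa using congrArg Units.val this
  have h2 : (u : ZMod p) - 1 ≠ 0 := by
    intro h
    have : u = 1 := Units.ext (by simpa using sub_eq_zero.1 h)
    rw [this, orderOf_one] at hu
    omega
  have h3 : (u : ZMod p) ^ 2 + u + 1 = 0 := by
    apply mul_left_cancel₀ h2
    linear_combination h1
  -- For a primitive cube root of unity `u`, `(2u + 1)² = 4(u² + u + 1) - 3`.
  exact ⟨2 * u + 1, by linear_combination (-4) * h3⟩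

theorem exists_sq_add_three_mul_sq {p : ℕ} (hp : p.Prime) (h : p % 3 = 1) :
    ∃ x y : ℤ, (p : ℤ) = x ^ 2 + 3 * y ^ 2 := by
  obtain ⟨x, y, h0, ⟨m, hm⟩, hx, hy⟩ := exists_small_sq_sub_mul_sq hp (c := -3)
    (by exact_mod_cast isSquare_neg_three_of_mod_three_eq_one hp h)
  have hpos : (0 : ℤ) < p := by exact_mod_cast hp.pos
  have h1 : 0 < x ^ 2 + 3 * y ^ 2 := by
    rcases h0 with h0 | h0 <;> positivity
  have hm0 : 0 < m := by
    by_contra! hcon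
    nlinarith
  have hm4 : m < 4 := by
    by_contra! hcon
    nlinarith
  have hp2 : p ≠ 2 := by rintro rfl; omega
  have hodd : p % 2 = 1 := hp.eq_two_or_odd.resolve_left hp2
  -- Here `x² + 3y² = mp` with `0 < m < 4`. The value 2 fails modulo 4, and for 3 the factor 3
  -- divides `x` and cancels.
  interval_cases m
  · exact ⟨x, y, by linarith⟩
  · exfalso
    rcases Int.even_or_odd' x with ⟨a, rfl | rfl⟩ <;> rcases Int.even_or_odd' y with ⟨b, rfl | rfl⟩ <;>
      ring_nf at hm <;> omega
  · have : (3 : ℤ) ∣ x := by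
      apply Int.prime_three.dvd_of_dvd_pow (n := 2)
      omega
    obtain ⟨a, rfl⟩ := this
    exact ⟨y, a, by linarith⟩

/-- By reciprocity 3 is a square modulo `p`, so Thue's lemma gives `x² - 3y² = mp` with `-3 < m <
1`; irrationality of `√3` excludes `m = 0`. -/
theorem exists_three_mul_sq_sub_sq {p : ℕ} (hp : p.Prime) (h : p % 12 = 11) :
    ∃ x y : ℤ, (p : ℤ) = 3 * y ^ 2 - x ^ 2 ∨ 2 * (p : ℤ) = 3 * y ^ 2 - x ^ 2 := by
  have h2 : ¬ IsSquare (2 : ZMod 3) := by decide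
  have : Fact p.Prime := ⟨hp⟩
  have : Fact (Nat.Prime 3) := ⟨Nat.prime_three⟩
  have hsq : IsSquare ((3 : ℤ) : ZMod p) := by
    have := (ZMod.exists_sq_eq_prime_iff_of_mod_four_eq_three (p := p) (q := 3) (by omega) (by omega)
      (by omega)).2
    rw [show ((3 : ℤ) : ZMod p) = ((3 : ℕ) : ZMod p) by norm_num]
    apply this
    have : (p : ZMod 3) = 2 := by
      have : ((p % 3 : ℕ) : ZMod 3) = p := ZMod.natCast_mod p 3
      rw [← this, show p % 3 = 2 by omega]; rfl
    rwa [this]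
  obtain ⟨x, y, h0, ⟨m, hm⟩, hx, hy⟩ := exists_small_sq_sub_mul_sq hp (c := 3) hsq
  have hpos : (0 : ℤ) < p := by exact_mod_cast hp.pos
  have hm1 : m < 1 := by
    by_contra! hcon
    nlinarith [sq_nonneg y]
  have hm3 : -3 < m := by
    by_contra! hcon
    nlinarith [sq_nonneg x]
  interval_cases m
  · exact ⟨x, y, Or.inr (by linarith)⟩
  · exact ⟨x, y, Or.inl (by linarith)⟩
  · exfalso
    have hy0 : y ≠ 0 := by
      rintro rfl
      simp at hm
      simp [hm] at h0
    have h3 : ¬ IsSquare (3 : ℚ) := by norm_num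
    apply h3
    refine ⟨x / y, ?_⟩
    have : (y : ℚ) ≠ 0 := by exact_mod_cast hy0
    field_simp
    have : x ^ 2 = 3 * y ^ 2 := by linarith
    exact_mod_cast this.symm

/-! ### Consequences of an odd class number, and units modulo squares. -/

/-- Elements of `L` which are a unit of `𝓞 L` times a nonzero square. -/
def IsUnitMulSq (L : Type*) [Field L] (x : L) : Prop :=
  ∃ (u : (𝓞 L)ˣ) (z : L), z ≠ 0 ∧ x = ((u : 𝓞 L) : L) * z ^ 2

section

variable {L : Type*} [Field L]

theorem IsUnitMulSq.of_unit (u : (𝓞 L)ˣ) : IsUnitMulSq L ((u : 𝓞 L) : L) :=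
  ⟨u, 1, one_ne_zero, by simp⟩

theorem isUnitMulSq_neg_one : IsUnitMulSq L (-1) :=
  ⟨-1, 1, one_ne_zero, by simp⟩

variable [NumberField L]

/-- The class of `I` is killed by 2 and by the odd class number, so `I` is principal and `x` is
associated to the square of its generator. -/
theorem isUnitMulSq_of_span_eq_sq (hL : Odd (classNumber L)) {x : 𝓞 L} (hx : x ≠ 0)
    {I : Ideal (𝓞 L)} (hI : I ^ 2 = Ideal.span {x}) : IsUnitMulSq L (x : L) := by
  have hprin : I.IsPrincipal :=
    Ideal.IsPrincipal.of_isPrincipal_pow_of_coprime (Nat.coprime_two_left.2 hL) (n := 2)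
      (by rw [hI]; exact ⟨x, rfl⟩)
  obtain ⟨α, rfl⟩ := hprin
  rw [Ideal.submodule_span_eq, Ideal.span_singleton_pow, Ideal.span_singleton_eq_span_singleton] at hI
  obtain ⟨u, hu⟩ := hI
  have hα : α ≠ 0 := by rintro rfl; simp [eq_comm, hx] at hu
  refine ⟨u, (α : L), by simpa using hα, ?_⟩
  rw [← hu]
  push_cast
  ring

open Units in
/-- If the unit rank is at most one, the units modulo squares have dimension at most two
over the field with two elements. -/
theorem exists_unit_prod_eq_sq (hrank : rank L ≤ 1) (u : Fin 3 → (𝓞 L)ˣ) :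
    ∃ c : Fin 3 → Fin 2, c ≠ 0 ∧ ∃ v : (𝓞 L)ˣ, ∏ i, u i ^ (c i : ℕ) = v ^ 2 := by
  obtain ⟨ε, hε⟩ : ∃ ε : (𝓞 L)ˣ, ∀ x : (𝓞 L)ˣ, ∃ ζ ∈ torsion L, ∃ j : ℤ, x = ζ * ε ^ j := by
    rcases Nat.le_one_iff_eq_zero_or_eq_one.1 hrank with h | h
    · have : IsEmpty (Fin (rank L)) := by rw [h]; infer_instance
      refine ⟨1, fun x => ?_⟩
      obtain ⟨ζ, hζ, -⟩ := exist_unique_eq_mul_prod L x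
      exact ⟨ζ.1, ζ.1.2, 0, by simpa using hζ⟩
    · have : Unique (Fin (rank L)) := by rw [h]; infer_instance
      refine ⟨fundSystem L default, fun x => ?_⟩
      obtain ⟨ζ, hζ, -⟩ := exist_unique_eq_mul_prod L x
      exact ⟨ζ.1, ζ.1.2, ζ.2 default, by simpa using hζ⟩
  obtain ⟨ζ, hζ⟩ := IsCyclic.exists_generator (α := torsion L)
  have key : ∀ x : (𝓞 L)ˣ, ∃ k : ℤ × ℤ, x = (ζ : (𝓞 L)ˣ) ^ k.1 * ε ^ k.2 := by
    intro x
    obtain ⟨ξ, hξ, j, rfl⟩ := hε x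
    obtain ⟨i, hi⟩ := Subgroup.mem_zpowers_iff.1 (hζ ⟨ξ, hξ⟩)
    refine ⟨(i, j), ?_⟩
    have : ((ζ ^ i : torsion L) : (𝓞 L)ˣ) = ξ := by rw [hi]
    simp [← this]
  choose k hk using key
  -- Three vectors in a plane over the field with two elements are dependent; they will be the
  -- exponents of `ζ` and `ε` modulo 2.
  have comb : ∀ v : Fin 3 → ZMod 2 × ZMod 2, ∃ c : Fin 3 → Fin 2, c ≠ 0 ∧
      ∑ i, ((c i : ℕ) : ZMod 2) * (v i).1 = 0 ∧ ∑ i, ((c i : ℕ) : ZMod 2) * (v i).2 = 0 := by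
    decide
  obtain ⟨c, hc, h1, h2⟩ := comb fun i => (((k (u i)).1 : ZMod 2), ((k (u i)).2 : ZMod 2))
  have e1 : (2 : ℤ) ∣ ∑ i, (c i : ℕ) * (k (u i)).1 :=
    (ZMod.intCast_zmod_eq_zero_iff_dvd _ 2).1 (by push_cast; exact h1)
  have e2 : (2 : ℤ) ∣ ∑ i, (c i : ℕ) * (k (u i)).2 :=
    (ZMod.intCast_zmod_eq_zero_iff_dvd _ 2).1 (by push_cast; exact h2)
  obtain ⟨m, hm⟩ := e1
  obtain ⟨n, hn⟩ := e2
  refine ⟨c, hc, (ζ : (𝓞 L)ˣ) ^ m * ε ^ n, ?_⟩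
  have : ∀ i, u i ^ (c i : ℕ) = (ζ : (𝓞 L)ˣ) ^ ((c i : ℕ) * (k (u i)).1) *
      ε ^ ((c i : ℕ) * (k (u i)).2) := by
    intro i
    conv_lhs => rw [hk (u i)]
    rw [mul_pow, ← zpow_natCast, ← zpow_natCast, ← zpow_mul, ← zpow_mul, mul_comm (k (u i)).1,
      mul_comm (k (u i)).2]
  simp_rw [this]
  rw [Fin.sum_univ_three] at hm hn
  rw [Finset.prod_mul_distrib, Fin.prod_univ_three, Fin.prod_univ_three, ← zpow_add, ← zpow_add,
    ← zpow_add, ← zpow_add, hm, hn, mul_comm 2 m, mul_comm 2 n, zpow_mul, zpow_mul, ← mul_zpow]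
  rfl

theorem exists_prod_eq_sq (hrank : Units.rank L ≤ 1) {x : Fin 3 → L}
    (hx : ∀ i, IsUnitMulSq L (x i)) :
    ∃ c : Fin 3 → Fin 2, c ≠ 0 ∧ ∃ z : L, ∏ i, x i ^ (c i : ℕ) = z ^ 2 := by
  choose u z hz hu using hx
  obtain ⟨c, hc, v, hv⟩ := exists_unit_prod_eq_sq hrank u
  refine ⟨c, hc, ((v : 𝓞 L) : L) * ∏ i, z i ^ (c i : ℕ), ?_⟩
  have hv' := congrArg (fun w : (𝓞 L)ˣ => ((w : 𝓞 L) : L)) hv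
  simp only [Units.coe_prod, Units.val_pow_eq_pow_val, map_prod, map_pow] at hv'
  simp_rw [hu, mul_pow, Finset.prod_mul_distrib, hv', ← Finset.prod_pow, ← pow_mul, mul_comm]

theorem unitRank_le_one_of_sq_eq_neg_three (h4 : Module.finrank ℚ L = 4) {s : L} (hs : s ^ 2 = -3) :
    Units.rank L ≤ 1 := by
  have : IsTotallyComplex L := by
    refine ⟨fun v => ?_⟩
    rw [← InfinitePlace.not_isReal_iff_isComplex]
    intro hv
    have h := congrArg (InfinitePlace.embedding_of_isReal hv) hs
    simp only [map_pow, map_neg, map_ofNat] at h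
    nlinarith [sq_nonneg (InfinitePlace.embedding_of_isReal hv s)]
  have h1 := InfinitePlace.card_eq_nrRealPlaces_add_nrComplexPlaces L
  have h2 := InfinitePlace.card_add_two_mul_card_eq_rank L
  have h3 := nrRealPlaces_eq_zero_iff.2 this
  unfold Units.rank
  omega

/-- If the class number is odd, an involution `σ` and an element `ρ` with `σ ρ = -ρ` such that `ρ²`
is a nontrivial sum of two squares of `σ`-invariant integers give a unit of relative norm `-1`. -/
theorem exists_unit_mul_eq_neg_one (hL : Odd (classNumber L)) (σ : 𝓞 L ≃+* 𝓞 L)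
    (hσ : ∀ x, σ (σ x) = x) {a b ρ : 𝓞 L} (ha : σ a = a) (hb : σ b = b) (hρ : σ ρ = -ρ)
    (hb0 : b ≠ 0) (h : ρ ^ 2 = a ^ 2 + b ^ 2) :
    ∃ η : (𝓞 L)ˣ, (η : 𝓞 L) * σ η = -1 := by
  set J : Ideal (𝓞 L) := Ideal.span {b, a + ρ} with hJ
  have hJ0 : J ≠ 0 := fun h0 => hb0 <| by
    have : b ∈ J := Ideal.subset_span (by simp)
    simpa [h0] using this
  -- Since `(a + ρ)(a - ρ) = -b²`, the ideal `J` and its conjugate differ by the factor `(a + ρ) /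
  -- b`, whose relative norm is `-1`. Raising to the odd power `n` makes `J` principal and keeps the
  -- sign.
  have hJσ : Ideal.span {a + ρ} * J.map σ = Ideal.span {b} * J := by
    rw [hJ, Ideal.map_span, Set.image_pair, hb, map_add, ha, hρ, Ideal.span_mul_span,
      Ideal.span_mul_span, Set.singleton_mul, Set.singleton_mul, Set.image_pair, Set.image_pair]
    have e1 : (a + ρ) * (a + -ρ) = -(b * b) := by linear_combination -h
    rw [e1, Ideal.span_pair_comm, Ideal.span_insert, Ideal.span_singleton_neg,
      ← Ideal.span_insert, mul_comm b (a + ρ)]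
  set n := classNumber L with hn
  obtain ⟨y, hy⟩ : (J ^ n).IsPrincipal := by
    rw [← ClassGroup.mk0_eq_one_iff (pow_mem (mem_nonZeroDivisors_of_ne_zero hJ0) n),
      ← SubmonoidClass.mk_pow _ (mem_nonZeroDivisors_of_ne_zero hJ0), map_pow]
    exact pow_card_eq_one
  rw [Ideal.submodule_span_eq] at hy
  have hy0 : y ≠ 0 := by
    rintro rfl
    rw [Ideal.span_singleton_eq_bot.2 rfl] at hy
    exact hJ0 ((pow_eq_zero_iff hL.pos.ne').1 hy)
  have hpow := congrArg (· ^ n) hJσ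
  simp only [mul_pow, ← Ideal.map_pow, hy, Ideal.map_span, Set.image_singleton,
    Ideal.span_singleton_pow, Ideal.span_singleton_mul_span_singleton] at hpow
  obtain ⟨η, hη⟩ := Ideal.span_singleton_eq_span_singleton.1 hpow.symm
  refine ⟨η, ?_⟩
  have hη' := congrArg σ hη
  simp only [map_mul, map_pow, map_add, ha, hb, hρ, hσ] at hη'
  have hσy : σ y ≠ 0 := by simpa using hy0
  have hc : (b ^ n * y) * (b ^ n * σ y) ≠ 0 := by positivity
  apply mul_left_cancel₀ hc
  have e1 : ((a + ρ) * (a + -ρ)) ^ n = - (b ^ n * b ^ n) := by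
    rw [show (a + ρ) * (a + -ρ) = -(b * b) by linear_combination -h, hL.neg_pow, mul_pow]
  calc _ = (b ^ n * y * η) * (b ^ n * σ y * σ η) := by ring
    _ = ((a + ρ) * (a + -ρ)) ^ n * (y * σ y) := by rw [hη, hη', mul_pow]; ring
    _ = _ := by rw [e1]; ring

end

/-! ### Ideals with principal square. -/

/-- The square is generated by `x²`, `xρ` and `xy`, that is, `x` times an ideal containing the
coprime `x` and `y`. -/
theorem Ideal.span_pair_sq_eq_of_isCoprime {R : Type*} [CommRing R] {x y ρ : R}
    (h : ρ ^ 2 = x * y) (hxy : IsCoprime x y) :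
    Ideal.span {x, ρ} ^ 2 = Ideal.span {x} := by
  rw [pow_two, Ideal.span_pair_mul_span_pair]
  apply le_antisymm
  · rw [Ideal.span_le]
    rintro z (rfl | rfl | rfl | rfl) <;> rw [SetLike.mem_coe, Ideal.mem_span_singleton]
    · exact dvd_mul_right _ _
    · exact dvd_mul_right _ _
    · exact dvd_mul_left _ _
    · exact ⟨y, by rw [← h, pow_two]⟩
  · rw [Ideal.span_singleton_le_iff_mem]
    obtain ⟨u, v, huv⟩ := hxy
    have : x = u * (x * x) + v * (ρ * ρ) := by linear_combination (-x) * huv - v * h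
    refine (congrArg (· ∈ _) this).mpr ?_
    exact add_mem (Ideal.mul_mem_left _ _ (Ideal.subset_span (by simp)))
      (Ideal.mul_mem_left _ _ (Ideal.subset_span (by simp)))

/-- This is the ramification of 2 in `ℚ(√d)` for `d ≡ 3 (mod 4)`. -/
theorem Ideal.span_two_one_add_sq {R : Type*} [CommRing R] {ρ k : R} (h : ρ ^ 2 = 4 * k + 3) :
    Ideal.span {2, 1 + ρ} ^ 2 = Ideal.span {2} := by
  rw [pow_two, Ideal.span_pair_mul_span_pair]
  apply le_antisymm
  · rw [Ideal.span_le]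
    rintro z (rfl | rfl | rfl | rfl) <;> rw [SetLike.mem_coe, Ideal.mem_span_singleton]
    · exact dvd_mul_right _ _
    · exact dvd_mul_right _ _
    · exact dvd_mul_left _ _
    · exact ⟨2 * k + 2 + ρ, by linear_combination h⟩
  · rw [Ideal.span_singleton_le_iff_mem]
    have : (2 : R) = (1 + ρ) * (1 + ρ) + ((-1) * (2 * (1 + ρ)) + (-k) * (2 * 2)) := by
      linear_combination (-1) * h
    refine (congrArg (· ∈ _) this).mpr ?_
    exact add_mem (Ideal.subset_span (by simp)) (add_mem
      (Ideal.mul_mem_left _ _ (Ideal.subset_span (by simp)))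
      (Ideal.mul_mem_left _ _ (Ideal.subset_span (by simp))))

/-! ### Squares and special elements in the biquadratic field. -/

/-- A presentation of `L` as the biquadratic field `ℚ(√d, √-3)`. -/
structure BiquadraticData (L : Type*) [Field L] [NumberField L] (d : ℤ) where
  r : L
  s : L
  σ : L ≃ₐ[ℚ] L
  τ : L ≃ₐ[ℚ] L
  r_sq : r ^ 2 = d
  s_sq : s ^ 2 = -3
  σ_r : σ r = -r
  σ_s : σ s = s
  τ_r : τ r = r
  τ_s : τ s = -s
  exists_eq : ∀ z : L, ∃ a b c e : ℚ, z = a + b * r + c * s + e * (r * s)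
  finrank_eq : Module.finrank ℚ L = 4

namespace BiquadraticData

variable {L : Type*} [Field L] [NumberField L] {d : ℤ} (D : BiquadraticData L d)

include D

theorem σ_σ (z : L) : D.σ (D.σ z) = z := by
  obtain ⟨a, b, c, e, rfl⟩ := D.exists_eq z
  simp [D.σ_r, D.σ_s]

theorem τ_τ (z : L) : D.τ (D.τ z) = z := by
  obtain ⟨a, b, c, e, rfl⟩ := D.exists_eq z
  simp [D.τ_r, D.τ_s]

theorem σ_τ (z : L) : D.σ (D.τ z) = D.τ (D.σ z) := by
  obtain ⟨a, b, c, e, rfl⟩ := D.exists_eq z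
  simp [D.σ_r, D.σ_s, D.τ_r, D.τ_s]

theorem exists_rat_of_fixed {z : L} (hσ : D.σ z = z) (hτ : D.τ z = z) : ∃ q : ℚ, z = q := by
  obtain ⟨a, b, c, e, h⟩ := D.exists_eq z
  refine ⟨a, ?_⟩
  have h1 : D.σ z = a - b * D.r + c * D.s - e * (D.r * D.s) := by
    rw [h]; simp [D.σ_r, D.σ_s]; ring
  have h2 : D.τ z = a + b * D.r - c * D.s - e * (D.r * D.s) := by
    rw [h]; simp [D.τ_r, D.τ_s]; ring
  have h3 : D.τ (D.σ z) = a - b * D.r - c * D.s + e * (D.r * D.s) := by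
    rw [h1]; simp [D.τ_r, D.τ_s]; ring
  rw [hσ] at h1 h3
  rw [hτ] at h2 h3
  linear_combination (1 / 4 : L) * (h + h1 + h2 + h3)

theorem isSquare_of_fixed {q : ℤ} {z : L} (hσ : D.σ z = z) (hτ : D.τ z = z) (h : z ^ 2 = q) :
    IsSquare q := by
  obtain ⟨t, rfl⟩ := D.exists_rat_of_fixed hσ hτ
  rw [← Rat.isSquare_intCast_iff]
  refine ⟨t, ?_⟩
  rw [← pow_two]
  exact_mod_cast h.symm

theorem exists_fixed_of_sq {z : L} (h : D.σ (z ^ 2) = z ^ 2) :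
    ∃ w, D.σ w = w ∧ (w = z ∨ w = z * D.r) := by
  rw [map_pow, sq_eq_sq_iff_eq_or_eq_neg] at h
  rcases h with h | h
  · exact ⟨z, h, Or.inl rfl⟩
  · exact ⟨z * D.r, by rw [map_mul, h, D.σ_r, neg_mul_neg], Or.inr rfl⟩

theorem isSquare_of_sq_of_σ {q : ℤ} {z : L} (hσ : D.σ z = z) (h : z ^ 2 = q) :
    IsSquare q ∨ IsSquare (-3 * q) := by
  have h' : D.τ z ^ 2 = z ^ 2 := by rw [← map_pow, h, map_intCast]
  rcases sq_eq_sq_iff_eq_or_eq_neg.1 h' with h1 | h1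
  · exact Or.inl (D.isSquare_of_fixed hσ h1 h)
  · refine Or.inr (D.isSquare_of_fixed (z := z * D.s) ?_ ?_ ?_)
    · rw [map_mul, hσ, D.σ_s]
    · rw [map_mul, h1, D.τ_s, neg_mul_neg]
    · rw [mul_pow, h, D.s_sq]; push_cast; ring

/-- The rationals that become squares in `L` are `1`, `d`, `-3`, `-3d` up to rational squares;
divisibility by 3 excludes the last two. -/
theorem pos_and_isSquare_of_sq (hd : 0 < d) (hd3 : ¬ (3 : ℤ) ∣ d) {q : ℤ} (hq3 : ¬ (3 : ℤ) ∣ q)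
    {z : L} (h : z ^ 2 = q) : 0 < q ∧ (IsSquare q ∨ IsSquare (d * q)) := by
  have hq0 : q ≠ 0 := by rintro rfl; simp at hq3
  have aux : ∀ m : ℤ, ¬ (3 : ℤ) ∣ m → ¬ IsSquare (-3 * m) := by
    rintro m hm ⟨t, ht⟩
    have : (3 : ℤ) ∣ t := Int.prime_three.dvd_of_dvd_pow (n := 2) ⟨-m, by linarith⟩
    obtain ⟨u, rfl⟩ := this
    exact hm ⟨-(u * u), by linarith⟩
  have hdq : ¬ (3 : ℤ) ∣ d * q := fun hh => (Int.prime_three.dvd_or_dvd hh).elim hd3 hq3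
  obtain ⟨w, hw, hwz⟩ := D.exists_fixed_of_sq (z := z) (by rw [h, map_intCast])
  rcases hwz with rfl | rfl
  · have h1 := (D.isSquare_of_sq_of_σ hw h).resolve_right (aux q hq3)
    exact ⟨lt_of_le_of_ne h1.nonneg hq0.symm, Or.inl h1⟩
  · have h1 := (D.isSquare_of_sq_of_σ (q := d * q) hw
      (by rw [mul_pow, h, D.r_sq]; push_cast; ring)).resolve_right (aux _ hdq)
    have h2 := h1.nonneg
    exact ⟨lt_of_le_of_ne (nonneg_of_mul_nonneg_right h2 hd) hq0.symm, Or.inr h1⟩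

/-- Either `z` or `z√d` lies in `ℚ(√-3)`; taking norms to `ℚ` shows that `N` or `d²N` is a square.
-/
theorem isSquare_of_sq_of_norm (hd : d ≠ 0) {m z : L} (hm : D.σ m = m) (h : z ^ 2 = m) {N : ℤ}
    (hN : m * D.τ m = N) : IsSquare N := by
  obtain ⟨w, hw, hwz⟩ := D.exists_fixed_of_sq (z := z) (by rw [h, hm])
  have h1 : D.σ (w * D.τ w) = w * D.τ w := by rw [map_mul, D.σ_τ, hw]
  have h2 : D.τ (w * D.τ w) = w * D.τ w := by rw [map_mul, D.τ_τ, mul_comm]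
  rcases hwz with rfl | rfl
  · exact D.isSquare_of_fixed h1 h2 (by rw [mul_pow, ← map_pow, h, hN])
  · obtain ⟨t, ht⟩ := D.isSquare_of_fixed (q := d ^ 2 * N) h1 h2 (by
      rw [map_mul, D.τ_r, mul_mul_mul_comm, mul_pow, mul_pow, ← map_pow, h, hN, mul_pow,
        D.r_sq]
      push_cast; ring)
    rw [← Rat.isSquare_intCast_iff]
    refine ⟨t / d, ?_⟩
    have : (d : ℚ) ≠ 0 := by exact_mod_cast hd
    field_simp
    have : N * d ^ 2 = t ^ 2 := by linarith
    exact_mod_cast this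

/-- The set of integers which are sums of two squares of `σ`-invariant elements. -/
def sumSq : Submonoid ℤ where
  carrier := {m | ∃ a b : L, D.σ a = a ∧ D.σ b = b ∧ (m : L) = a ^ 2 + b ^ 2}
  one_mem' := ⟨1, 0, by simp, by simp, by simp⟩
  mul_mem' := by
    rintro m n ⟨a, b, ha, hb, h⟩ ⟨a', b', ha', hb', h'⟩
    refine ⟨a * a' - b * b', a * b' + b * a', by simp [*], by simp [*], ?_⟩
    push_cast
    rw [h, h']
    ring

theorem prime_mem_sumSq {p : ℕ} (hp : p.Prime) (h : p % 3 = 2) : (p : ℤ) ∈ D.sumSq := by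
  have : Fact p.Prime := ⟨hp⟩
  by_cases h4 : p % 4 = 3
  · have aux : ∀ x y : ℤ, ∃ a b : L, D.σ a = a ∧ D.σ b = b ∧
        ((3 * y ^ 2 - x ^ 2 : ℤ) : L) = a ^ 2 + b ^ 2 := by
      intro x y
      have hs := D.s_sq
      -- `ω = (-1 + s) / 2` is a cube root of unity, and `-1 = ω ^ 2 + (ω ^ 2) ^ 2`
      refine ⟨(-1 + D.s) / 2 * x - (-1 - D.s) / 2 * (D.s * y),
        (-1 + D.s) / 2 * (D.s * y) + (-1 - D.s) / 2 * x, ?_, ?_, ?_⟩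
      · simp [D.σ_s, map_ofNat D.σ 2]
      · simp [D.σ_s, map_ofNat D.σ 2]
      · push_cast
        linear_combination (-(x : L) ^ 2 / 2 - (D.s ^ 2 - 2) / 2 * (y : L) ^ 2) * hs
    obtain ⟨x, y, hxy⟩ := exists_three_mul_sq_sub_sq hp (by omega)
    obtain ⟨a, b, ha, hb, hab⟩ := aux x y
    rcases hxy with hxy | hxy
    · exact ⟨a, b, ha, hb, by rw [hxy, hab]⟩
    · rw [← hxy] at hab
      push_cast at hab
      -- If `2p = a² + b²`, these halves have squares summing to `p`.
      refine ⟨(a + b) / 2, (a - b) / 2, by simp [*, map_ofNat D.σ 2],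
        by simp [*, map_ofNat D.σ 2], ?_⟩
      push_cast
      linear_combination (1 / 2 : L) * hab
  · obtain ⟨a, b, hab⟩ := Nat.Prime.sq_add_sq h4
    exact ⟨a, b, by simp, by simp, by rw [← hab]; push_cast; ring⟩

theorem mem_sumSq (n : ℕ) (hn : n ≠ 0) (h : ∀ p : ℕ, p.Prime → p ∣ n → p % 3 = 2) :
    (n : ℤ) ∈ D.sumSq := by
  induction n using induction_on_primes with
  | zero => exact absurd rfl hn
  | one => exact D.sumSq.one_mem
  | prime_mul p a hp ih =>
    push_cast
    exact D.sumSq.mul_mem (D.prime_mem_sumSq hp (h p hp (dvd_mul_right _ _)))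
      (ih (right_ne_zero_of_mul hn) fun q hq hqa => h q hq (hqa.mul_left _))

theorem isIntegral_r : IsIntegral ℤ D.r :=
  IsIntegral.of_pow two_pos (by rw [D.r_sq]; exact isIntegral_algebraMap (R := ℤ) (x := d))

theorem isIntegral_s : IsIntegral ℤ D.s :=
  IsIntegral.of_pow two_pos (by
    rw [D.s_sq]; exact_mod_cast isIntegral_algebraMap (R := ℤ) (A := L) (x := -3))

theorem exists_integer_r : ∃ ρ : 𝓞 L, (ρ : L) = D.r ∧ ρ ^ 2 = d := by
  obtain ⟨ρ, hρ⟩ : ∃ ρ : 𝓞 L, (ρ : L) = D.r := ⟨⟨_, D.isIntegral_r⟩, rfl⟩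
  exact ⟨ρ, hρ, RingOfIntegers.ext (by simp [hρ, D.r_sq])⟩

theorem exists_integer_s : ∃ s : 𝓞 L, (s : L) = D.s ∧ s ^ 2 = -3 := by
  obtain ⟨s, hs⟩ : ∃ s : 𝓞 L, (s : L) = D.s := ⟨⟨_, D.isIntegral_s⟩, rfl⟩
  have h3 : ((3 : 𝓞 L) : L) = 3 := map_ofNat (algebraMap (𝓞 L) L) 3
  exact ⟨s, hs, RingOfIntegers.ext (by simp [hs, D.s_sq, h3])⟩

theorem exists_isUnitMulSq_norm_eq_neg_one (hL : Odd (classNumber L)) (hd : d ≠ 0)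
    (h : d ∈ D.sumSq) : ∃ e : L, IsUnitMulSq L e ∧ e * D.σ e = -1 := by
  obtain ⟨a, b, ha, hb, hab⟩ := h
  have hr0 : D.r ≠ 0 := by
    intro h0
    have := D.r_sq
    rw [h0] at this
    exact hd (by simpa using this.symm)
  have hb0 : b ≠ 0 := by
    rintro rfl
    have : D.r ^ 2 = a ^ 2 := by rw [D.r_sq, hab]; ring
    have hσ := D.σ_r
    have h2 : D.σ D.r = D.r := by
      rcases sq_eq_sq_iff_eq_or_eq_neg.1 this with h | h <;> rw [h] <;> simp [ha]
    rw [h2, eq_comm, neg_eq_self] at hσ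
    exact hr0 hσ
  -- Clearing the denominators of `a` and `b` by the integer `m * n` gives the integral relation `ρ²
  -- = a'² + b'²`.
  have : Algebra.IsAlgebraic ℤ L :=
    (IsFractionRing.comap_isAlgebraic_iff (A := ℤ) (K := ℚ)).2 inferInstance
  have alg : ∀ x : L, IsAlgebraic ℤ x := Algebra.IsAlgebraic.isAlgebraic
  obtain ⟨m, hm, hma⟩ := (alg a).exists_integral_multiple
  obtain ⟨n, hn, hnb⟩ := (alg b).exists_integral_multiple
  obtain ⟨ρ, hρ⟩ : ∃ ρ : 𝓞 L, (ρ : L) = ((m * n : ℤ) : L) * D.r :=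
    ⟨⟨_, D.isIntegral_r.smul (m * n)⟩, zsmul_eq_mul _ _⟩
  obtain ⟨a', ha'⟩ : ∃ a' : 𝓞 L, (a' : L) = ((m * n : ℤ) : L) * a :=
    ⟨⟨_, hma.smul n⟩, by simp only [RingOfIntegers.map_mk, zsmul_eq_mul]; push_cast; ring⟩
  obtain ⟨b', hb'⟩ : ∃ b' : 𝓞 L, (b' : L) = ((m * n : ℤ) : L) * b :=
    ⟨⟨_, hnb.smul m⟩, by simp only [RingOfIntegers.map_mk, zsmul_eq_mul]; push_cast; ring⟩
  obtain ⟨η, hη⟩ := exists_unit_mul_eq_neg_one hL (RingOfIntegers.mapRingEquiv D.σ.toRingEquiv)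
    (fun x => RingOfIntegers.ext (D.σ_σ x)) (a := a') (b := b') (ρ := ρ)
    (RingOfIntegers.ext (by simp [ha', ha]))
    (RingOfIntegers.ext (by simp [hb', hb]))
    (RingOfIntegers.ext (by simp [hρ, D.σ_r]))
    (by
      rintro rfl
      simp [hm, hn, hb0] at hb')
    (RingOfIntegers.ext (by simp [hρ, ha', hb', mul_pow, D.r_sq, hab]; ring))
  refine ⟨((η : 𝓞 L) : L), IsUnitMulSq.of_unit η, ?_⟩
  have := congrArg (fun x : 𝓞 L => (x : L)) hη
  simpa using this

theorem isUnitMulSq_intCast (hL : Odd (classNumber L)) {n m : ℤ} (hn : n ≠ 0) (h : d = n * m)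
    (hnm : IsCoprime n m) : IsUnitMulSq L (n : L) := by
  obtain ⟨ρ, -, hρ⟩ := D.exists_integer_r
  have := isUnitMulSq_of_span_eq_sq hL (x := (n : 𝓞 L)) (by exact_mod_cast hn)
    (Ideal.span_pair_sq_eq_of_isCoprime (y := (m : 𝓞 L)) (ρ := ρ)
      (by rw [hρ, h, Int.cast_mul]) (hnm.map (Int.castRingHom (𝓞 L))))
  simpa using this

theorem isUnitMulSq_two (hL : Odd (classNumber L)) (h : d % 4 = 3) : IsUnitMulSq L (2 : L) := by
  obtain ⟨ρ, -, hρ⟩ := D.exists_integer_r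
  have h' : (d : 𝓞 L) = 4 * (d / 4 : ℤ) + 3 := by
    have : d = 4 * (d / 4) + 3 := by omega
    exact_mod_cast congrArg (Int.cast : ℤ → 𝓞 L) this
  have := isUnitMulSq_of_span_eq_sq hL (x := (2 : 𝓞 L)) two_ne_zero
    (Ideal.span_two_one_add_sq (hρ.trans h'))
  rwa [show ((2 : 𝓞 L) : L) = 2 from map_ofNat (algebraMap (𝓞 L) L) 2] at this

/-- Write `p = x² + 3y²` and `π = x + y√-3`. As `p ∤ 2x`, `π` is coprime to its conjugate, hence to
the cofactor in `d = π · (x - y√-3) · m`; since `d` is a square in `L`, `(π)` is the square of an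
ideal. -/
theorem exists_isUnitMulSq_of_prime (hL : Odd (classNumber L)) {p : ℕ} (hp : p.Prime)
    (hp3 : p % 3 = 1) {m : ℤ} (h : d = p * m) (hpm : IsCoprime (p : ℤ) m) :
    ∃ π : L, IsUnitMulSq L π ∧ D.σ π = π ∧ π * D.τ π = p := by
  obtain ⟨x, y, hxy⟩ := exists_sq_add_three_mul_sq hp hp3
  have hpZ : Prime (p : ℤ) := Nat.prime_iff_prime_int.1 hp
  have hpx : ¬ (p : ℤ) ∣ 2 * x := by
    intro hdvd
    rcases hpZ.dvd_or_dvd hdvd with h2 | hx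
    · have : p ∣ 2 := by exact_mod_cast h2
      rw [Nat.prime_dvd_prime_iff_eq hp Nat.prime_two] at this
      omega
    · have h3 : (p : ℤ) ∣ 3 * y ^ 2 := by
        rw [show 3 * y ^ 2 = p - x * x by rw [hxy]; ring]
        exact dvd_sub dvd_rfl (hx.mul_right _)
      have hy : (p : ℤ) ∣ y := by
        rcases hpZ.dvd_or_dvd h3 with h3 | h3
        · have : p ∣ 3 := by exact_mod_cast h3
          rw [Nat.prime_dvd_prime_iff_eq hp Nat.prime_three] at this
          omega
        · exact hpZ.dvd_of_dvd_pow h3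
      obtain ⟨a, rfl⟩ := hx
      obtain ⟨b, rfl⟩ := hy
      have h0 : (p : ℤ) ≠ 0 := hpZ.ne_zero
      have h1 : (p : ℤ) * (a ^ 2 + 3 * b ^ 2) = 1 := by
        apply mul_left_cancel₀ h0
        linear_combination (-1) * hxy
      exact hpZ.not_isUnit (IsUnit.of_mul_eq_one _ h1)
  obtain ⟨u, v, huv⟩ : IsCoprime (2 * x) (p : ℤ) := (hpZ.coprime_iff_not_dvd.2 hpx).symm
  obtain ⟨ρ, -, hρ⟩ := D.exists_integer_r
  obtain ⟨s, hs, hs2⟩ := D.exists_integer_s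
  have hprod : (x + y * s) * (x - y * s) = (p : 𝓞 L) := by
    have : (p : 𝓞 L) = x ^ 2 + 3 * y ^ 2 := by exact_mod_cast congrArg (Int.cast : ℤ → 𝓞 L) hxy
    rw [this]
    linear_combination (-(y : 𝓞 L) ^ 2) * hs2
  have hcop1 : IsCoprime (x + y * s) (x - y * s) := by
    refine ⟨u + v * (x - y * s), u, ?_⟩
    have : (u * (2 * x) + v * p : 𝓞 L) = 1 := by
      exact_mod_cast congrArg (Int.cast : ℤ → 𝓞 L) huv
    linear_combination this + (v : 𝓞 L) * hprod
  have hcop2 : IsCoprime (x + y * s) (m : 𝓞 L) := by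
    have h1 : IsCoprime (p : 𝓞 L) (m : 𝓞 L) := by
      simpa using hpm.map (Int.castRingHom (𝓞 L))
    exact h1.of_isCoprime_of_dvd_left ⟨_, hprod.symm⟩
  refine ⟨x + y * D.s, ?_, by simp [D.σ_s], ?_⟩
  · have := isUnitMulSq_of_span_eq_sq hL (x := x + y * s) (by
        intro h0
        rw [h0, zero_mul] at hprod
        exact hp.ne_zero (by exact_mod_cast hprod.symm))
      (Ideal.span_pair_sq_eq_of_isCoprime (ρ := ρ) (y := (x - y * s) * m)
        (by rw [← mul_assoc, hprod, hρ, h]; simp)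
        (hcop1.mul_right hcop2))
    simpa [hs] using this
  · have := congrArg (fun z : 𝓞 L => (z : L)) hprod
    simpa [hs, D.τ_s, sub_eq_add_neg] using this

end BiquadraticData

/-! ### Independence modulo squares, and evenness of the class number. -/

theorem not_isSquare_of_squarefree_mul {n m : ℤ} (hn : 1 < n) (hm : 1 < m)
    (h : Squarefree (n * m)) : ¬ IsSquare n ∧ ¬ IsSquare (n * m * n) := by
  have aux : ∀ k : ℤ, 1 < k → Squarefree k → ¬ IsSquare k := by
    rintro k hk hsq ⟨t, rfl⟩
    have := hsq t dvd_rfl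
    rcases Int.isUnit_iff.1 this with rfl | rfl <;> omega
  refine ⟨aux n hn h.of_mul_left, ?_⟩
  rintro ⟨t, ht⟩
  apply aux m hm h.of_mul_right
  rw [← Rat.isSquare_intCast_iff]
  refine ⟨t / n, ?_⟩
  have h0 : (n : ℚ) ≠ 0 := by exact_mod_cast (by omega : n ≠ 0)
  field_simp
  have : m * n ^ 2 = t ^ 2 := by linear_combination ht
  exact_mod_cast this

namespace BiquadraticData

variable {L : Type*} [Field L] [NumberField L] {d : ℤ} (D : BiquadraticData L d)

include D

theorem exists_prod_eq_sq {x y w : L} (hx : IsUnitMulSq L x) (hy : IsUnitMulSq L y)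
    (hw : IsUnitMulSq L w) :
    ∃ a b c : Fin 2, ¬ (a = 0 ∧ b = 0 ∧ c = 0) ∧
      ∃ z : L, z ^ 2 = x ^ (a : ℕ) * y ^ (b : ℕ) * w ^ (c : ℕ) := by
  obtain ⟨c, hc, z, hz⟩ := _root_.exists_prod_eq_sq
    (unitRank_le_one_of_sq_eq_neg_three D.finrank_eq D.s_sq) (x := ![x, y, w])
    (by intro i; fin_cases i <;> assumption)
  refine ⟨c 0, c 1, c 2, ?_, z, ?_⟩
  · rintro ⟨h0, h1, h2⟩
    apply hc
    ext i
    fin_cases i <;> simp [*]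
  · rw [← hz, Fin.prod_univ_three]
    rfl

/-- The norm of `nπ` from `ℚ(√-3)` is `n²p`, not a square. -/
theorem sq_ne_mul_of_norm_prime (hd : d ≠ 0) {p : ℕ} (hp : p.Prime) {π : L} (hπ : D.σ π = π)
    (hN : π * D.τ π = p) {n : ℤ} (hn : n ≠ 0) (z : L) : z ^ 2 ≠ n * π := by
  intro h
  obtain ⟨t, ht⟩ := D.isSquare_of_sq_of_norm hd (N := n ^ 2 * p) (by simp [hπ]) h
    (by rw [map_mul, map_intCast]; push_cast; linear_combination (n : L) ^ 2 * hN)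
  have : IsSquare (p : ℚ) := by
    refine ⟨t / n, ?_⟩
    have h0 : (n : ℚ) ≠ 0 := by exact_mod_cast hn
    field_simp
    have : p * n ^ 2 = t ^ 2 := by linear_combination ht
    exact_mod_cast this
  rw [Rat.isSquare_natCast_iff] at this
  exact hp.not_isSquare this

section

variable (hd : 0 < d) (hd3 : ¬ (3 : ℤ) ∣ d)

include hd hd3

theorem sq_ne_neg_one (z : L) : z ^ 2 ≠ -1 := by
  intro h
  have := (D.pos_and_isSquare_of_sq hd hd3 (q := -1) (by decide) (by exact_mod_cast h)).1
  omega

theorem sq_ne_neg_one_pow_mul {n : ℤ} (hn3 : ¬ (3 : ℤ) ∣ n) (hn : 0 < n) (hnsq : ¬ IsSquare n)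
    (hdn : ¬ IsSquare (d * n)) (a c : Fin 2) (hac : ¬ (a = 0 ∧ c = 0)) (z : L) :
    z ^ 2 ≠ (-1) ^ (a : ℕ) * (n : L) ^ (c : ℕ) := by
  intro h
  fin_cases a <;> fin_cases c
  · simp at hac
  · have := (D.pos_and_isSquare_of_sq hd hd3 (q := n) hn3 (by simpa using h)).2
    tauto
  · exact D.sq_ne_neg_one hd hd3 z (by simpa using h)
  · have := (D.pos_and_isSquare_of_sq hd hd3 (q := -n) (by rwa [dvd_neg])
      (by simpa using h)).1
    omega

/-- The norm of `em` to `ℚ(√-3)` is `-m²`, so a square root of `em` would yield a square root of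
`-1` in `L`. -/
theorem sq_ne_mul_of_norm_eq_neg_one {e m z : L} (he : e * D.σ e = -1) (hm : D.σ m = m)
    (hm0 : m ≠ 0) : z ^ 2 ≠ e * m := by
  intro h
  apply D.sq_ne_neg_one hd hd3 (z * D.σ z / m)
  rw [div_pow, mul_pow, ← map_pow, h, map_mul, hm]
  field_simp
  linear_combination he

theorem not_isUnitMulSq_int_and_norm_prime {n : ℤ} (hn3 : ¬ (3 : ℤ) ∣ n) (hn : 0 < n)
    (hnsq : ¬ IsSquare n) (hdn : ¬ IsSquare (d * n)) (hnS : IsUnitMulSq L (n : L)) {p : ℕ}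
    (hp : p.Prime) {π : L} (hπ : D.σ π = π) (hN : π * D.τ π = p) : ¬ IsUnitMulSq L π := by
  intro hπS
  obtain ⟨a, b, c, h0, z, hz⟩ := D.exists_prod_eq_sq isUnitMulSq_neg_one hnS hπS
  by_cases hc : c = 0
  · subst hc
    exact D.sq_ne_neg_one_pow_mul hd hd3 hn3 hn hnsq hdn a b (by tauto) z (by simpa using hz)
  · obtain rfl : c = 1 := by omega
    exact D.sq_ne_mul_of_norm_prime hd.ne' hp hπ hN (n := (-1) ^ (a : ℕ) * n ^ (b : ℕ))
      (mul_ne_zero (by simp) (pow_ne_zero _ hn.ne')) z (by simpa using hz)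

theorem not_isUnitMulSq_int_and_norm_eq_neg_one {n : ℤ} (hn3 : ¬ (3 : ℤ) ∣ n) (hn : 0 < n)
    (hnsq : ¬ IsSquare n) (hdn : ¬ IsSquare (d * n)) (hnS : IsUnitMulSq L (n : L))
    {e : L} (he : e * D.σ e = -1) : ¬ IsUnitMulSq L e := by
  intro heS
  obtain ⟨a, b, c, h0, z, hz⟩ := D.exists_prod_eq_sq isUnitMulSq_neg_one hnS heS
  by_cases hc : c = 0
  · subst hc
    exact D.sq_ne_neg_one_pow_mul hd hd3 hn3 hn hnsq hdn a b (by tauto) z (by simpa using hz)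
  · obtain rfl : c = 1 := by omega
    have hn0 : (n : L) ≠ 0 := by exact_mod_cast hn.ne'
    exact D.sq_ne_mul_of_norm_eq_neg_one hd hd3 (m := (-1) ^ (a : ℕ) * (n : L) ^ (b : ℕ))
      (z := z) he (by simp) (mul_ne_zero (by simp) (pow_ne_zero _ hn0))
      (by rw [hz]; simp [mul_comm])

theorem not_isUnitMulSq_norm_prime_and_norm_eq_neg_one {p : ℕ}
    (hp : p.Prime) {π : L} (hπ : D.σ π = π) (hN : π * D.τ π = p) (hπS : IsUnitMulSq L π)
    {e : L} (he : e * D.σ e = -1) : ¬ IsUnitMulSq L e := by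
  intro heS
  obtain ⟨a, b, c, h0, z, hz⟩ := D.exists_prod_eq_sq isUnitMulSq_neg_one hπS heS
  have hπ0 : π ≠ 0 := by
    rintro rfl
    rw [zero_mul] at hN
    exact hp.ne_zero (by exact_mod_cast hN.symm)
  by_cases hc : c = 0
  · subst hc
    by_cases hb : b = 0
    · subst hb
      obtain rfl : a = 1 := by
        have : a ≠ 0 := by tauto
        omega
      exact D.sq_ne_neg_one hd hd3 z (by simpa using hz)
    · obtain rfl : b = 1 := by omega
      exact D.sq_ne_mul_of_norm_prime hd.ne' hp hπ hN (n := (-1) ^ (a : ℕ)) (by simp) z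
        (by simpa using hz)
  · obtain rfl : c = 1 := by omega
    exact D.sq_ne_mul_of_norm_eq_neg_one hd hd3 (m := (-1) ^ (a : ℕ) * π ^ (b : ℕ))
      (z := z) he (by simp [hπ]) (mul_ne_zero (by simp) (pow_ne_zero _ hπ0))
      (by rw [hz]; simp [mul_comm])

end

/-- The class number of `ℚ(√d, √-3)` is even if `d > 1` is squarefree and `d ≡ 1` modulo `3`. -/
theorem not_odd_classNumber (hd : 1 < d) (hsq : Squarefree d) (hmod : d % 3 = 1) :
    ¬ Odd (classNumber L) := by
  intro hL
  have hd0 : 0 < d := by omega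
  have hd3 : ¬ (3 : ℤ) ∣ d := by omega
  obtain ⟨k, rfl⟩ : ∃ k : ℕ, d = k := ⟨d.toNat, by omega⟩
  have hk : 1 < k := by exact_mod_cast hd
  have split : ∀ p : ℕ, p.Prime → p ∣ k → p ≠ k → ∃ m : ℤ, (k : ℤ) = p * m ∧
      IsCoprime (p : ℤ) m ∧ ¬ (3 : ℤ) ∣ p ∧ (0 : ℤ) < p ∧ ¬ IsSquare (p : ℤ) ∧
        ¬ IsSquare ((k : ℤ) * p) := by
    rintro p hp ⟨m, rfl⟩ hpk
    push_cast at hsq hd3 ⊢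
    have hm : 1 < m := by
      by_contra! hcon
      interval_cases m <;> simp_all
    have h := not_isSquare_of_squarefree_mul (n := p) (m := m) (by exact_mod_cast hp.one_lt)
      (by exact_mod_cast hm) hsq
    exact ⟨m, rfl, (squarefree_mul_iff.1 hsq).1.isCoprime, fun h3 => hd3 (h3.mul_right _),
      by exact_mod_cast hp.pos, h⟩
  by_cases hkp : k.Prime
  · have hk3 : k % 3 = 1 := by omega
    obtain ⟨π, hπS, hπ, hN⟩ := D.exists_isUnitMulSq_of_prime hL hkp hk3 (m := 1) (by simp)
      isCoprime_one_right
    have hk2 : k % 2 = 1 := hkp.eq_two_or_odd.resolve_left (by omega)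
    by_cases h4 : k % 4 = 3
    · have h2 := D.isUnitMulSq_two hL (by omega)
      refine D.not_isUnitMulSq_int_and_norm_prime hd0 hd3 (n := 2) (by decide) (by decide)
        (by norm_num) ?_ (by exact_mod_cast h2) hkp hπ hN hπS
      -- `2k` is not a square because `2k ≡ 2 (mod 4)`.
      rintro ⟨t, ht⟩
      rcases Int.even_or_odd' t with ⟨u, rfl | rfl⟩ <;> ring_nf at ht <;> omega
    · have : Fact k.Prime := ⟨hkp⟩
      obtain ⟨a, b, hab⟩ := Nat.Prime.sq_add_sq h4
      obtain ⟨e, heS, he⟩ := D.exists_isUnitMulSq_norm_eq_neg_one hL hd0.ne'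
        ⟨a, b, by simp, by simp, by rw [← hab]; push_cast; ring⟩
      exact D.not_isUnitMulSq_norm_prime_and_norm_eq_neg_one hd0 hd3 hkp hπ hN hπS he heS
  · by_cases hall : ∀ p : ℕ, p.Prime → p ∣ k → p % 3 = 2
    · obtain ⟨e, heS, he⟩ := D.exists_isUnitMulSq_norm_eq_neg_one hL hd0.ne'
        (D.mem_sumSq k (by omega) hall)
      have hp := Nat.minFac_prime (n := k) (by omega)
      obtain ⟨m, hm, hcop, h3, hpos, hs1, hs2⟩ := split _ hp (Nat.minFac_dvd k)
        (fun h => hkp (h ▸ hp))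
      exact D.not_isUnitMulSq_int_and_norm_eq_neg_one hd0 hd3 h3 hpos hs1 hs2
        (D.isUnitMulSq_intCast hL hpos.ne' hm hcop) he heS
    · push Not at hall
      obtain ⟨p, hp, hpk, hp3⟩ := hall
      obtain ⟨m, hm, hcop, h3, hpos, hs1, hs2⟩ := split p hp hpk (fun h => hkp (h ▸ hp))
      obtain ⟨π, hπS, hπ, hN⟩ := D.exists_isUnitMulSq_of_prime hL hp (by omega) hm hcop
      exact D.not_isUnitMulSq_int_and_norm_prime hd0 hd3 h3 hpos hs1 hs2
        (D.isUnitMulSq_intCast hL hpos.ne' hm hcop) hp hπ hN hπS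

end BiquadraticData

/-! ### Generalities on quadratic extensions. -/

section Quadratic

variable {F A : Type*} [Field F] [Field A] [Algebra F A]

theorem exists_eq_add_mul_of_finrank_eq_two (h2 : Module.finrank F A = 2) {x : A}
    (hx : x ∉ (algebraMap F A).range) (z : A) :
    ∃ a b : F, z = algebraMap F A a + algebraMap F A b * x := by
  have hli : LinearIndependent F ![1, x] := by
    rw [LinearIndependent.pair_iff]
    intro a b hab
    rw [Algebra.smul_def, Algebra.smul_def, mul_one] at hab
    have hb : b = 0 := by
      by_contra hb
      apply hx
      refine ⟨-a / b, ?_⟩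
      have : algebraMap F A b ≠ 0 := by simpa using hb
      rw [map_div₀, map_neg]
      field_simp
      linear_combination -hab
    subst hb
    simpa using hab
  have : FiniteDimensional F A := Module.finite_of_finrank_eq_succ h2
  have hspan := hli.span_eq_top_of_card_eq_finrank' (by simp [h2])
  have hz : z ∈ Submodule.span F (Set.range ![1, x]) := by rw [hspan]; trivial
  rw [Matrix.range_cons, Matrix.range_cons, Matrix.range_empty, Set.union_empty,
    Set.singleton_union, Submodule.mem_span_pair] at hz
  obtain ⟨a, b, hab⟩ := hz
  exact ⟨a, b, by rw [← hab, Algebra.smul_def, Algebra.smul_def, mul_one]⟩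

theorem exists_algEquiv_eq_neg [CharZero F] (h2 : Module.finrank F A = 2) {x : A}
    (hx : x ∉ (algebraMap F A).range) {c : F} (hc : x ^ 2 = algebraMap F A c) :
    ∃ σ : A ≃ₐ[F] A, σ x = -x := by
  have : Algebra.IsQuadraticExtension F A := ⟨h2⟩
  have : FiniteDimensional F A := Module.finite_of_finrank_eq_succ h2
  have hcard : Nat.card (A ≃ₐ[F] A) = 2 := by rw [IsGalois.card_aut_eq_finrank, h2]
  have : Nontrivial (A ≃ₐ[F] A) := by
    have : Finite (A ≃ₐ[F] A) := Nat.finite_of_card_ne_zero (by omega)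
    exact Finite.one_lt_card_iff_nontrivial.1 (by omega)
  obtain ⟨σ, hσ⟩ := exists_ne (1 : A ≃ₐ[F] A)
  refine ⟨σ, ?_⟩
  have h : σ x ^ 2 = x ^ 2 := by rw [← map_pow, hc, AlgEquiv.commutes]
  refine (sq_eq_sq_iff_eq_or_eq_neg.1 h).resolve_left fun h1 => hσ ?_
  ext z
  obtain ⟨a, b, rfl⟩ := exists_eq_add_mul_of_finrank_eq_two h2 hx z
  simp [h1]

theorem finrank_adjoin_eq_two_of_sq {x : A} {c : F} (hc : x ^ 2 = algebraMap F A c)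
    (hx : x ∉ (algebraMap F A).range) :
    Module.finrank F (IntermediateField.adjoin F {x}) = 2 := by
  have hmonic : (Polynomial.X ^ 2 - Polynomial.C c : Polynomial F).Monic :=
    Polynomial.monic_X_pow_sub_C c two_ne_zero
  have hroot : Polynomial.aeval x (Polynomial.X ^ 2 - Polynomial.C c) = 0 := by simp [hc]
  have hint : IsIntegral F x := ⟨_, hmonic, hroot⟩
  rw [IntermediateField.adjoin.finrank hint]
  apply le_antisymm
  · have := Polynomial.natDegree_le_of_dvd (minpoly.dvd F x hroot) hmonic.ne_zero
    rwa [Polynomial.natDegree_X_pow_sub_C] at this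
  · exact (minpoly.two_le_natDegree_iff hint).2 hx

theorem exists_sq_eq_algebraMap [CharZero F] (h2 : Module.finrank F A = 2) :
    ∃ x : A, x ∉ (algebraMap F A).range ∧ ∃ c : F, x ^ 2 = algebraMap F A c := by
  obtain ⟨y, hy⟩ : ∃ y : A, y ∉ (algebraMap F A).range := by
    by_contra! hcon
    have := Algebra.finrank_eq_one_iff_bijective_algebraMap.2
      ⟨(algebraMap F A).injective, hcon⟩
    omega
  obtain ⟨a, b, hab⟩ := exists_eq_add_mul_of_finrank_eq_two h2 hy (y ^ 2)
  have h20 : (2 : F) ≠ 0 := two_ne_zero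
  have h2A : (2 : A) = algebraMap F A 2 := (map_ofNat (algebraMap F A) 2).symm
  have h4A : (4 : A) = algebraMap F A 4 := (map_ofNat (algebraMap F A) 4).symm
  -- Completing the square in `y² = a + by`.
  refine ⟨2 * y - algebraMap F A b, ?_, 4 * a + b ^ 2, ?_⟩
  · rintro ⟨t, ht⟩
    refine hy ⟨2⁻¹ * (t + b), ?_⟩
    rw [map_mul, map_add, ht, sub_add_cancel, h2A, ← mul_assoc, ← map_mul, inv_mul_cancel₀ h20,
      map_one, one_mul]
  · rw [map_add, map_mul, map_pow, ← h4A]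
    linear_combination 4 * hab

end Quadratic

theorem exists_sq_eq_neg_three_adjoinSqrtNegThree (K : Type*) [Field K] :
    ∃ s : AdjoinSqrtNegThree K, s ^ 2 = -3 := by
  obtain ⟨s, hs⟩ := IsAlgClosed.exists_pow_nat_eq (-3 : AlgebraicClosure K) two_pos
  exact ⟨⟨s, IntermediateField.subset_adjoin _ _ hs⟩, Subtype.ext (by push_cast; exact hs)⟩

/-! ### Real quadratic fields, the prime 3, and adjoining `√-3`. -/

section RealQuadratic

variable {K : Type*} [Field K] [NumberField K]

theorem exists_real_embedding [IsTotallyReal K] : Nonempty (K →+* ℝ) :=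
  ⟨InfinitePlace.embedding_of_isReal (IsTotallyReal.isReal (Classical.arbitrary (InfinitePlace K)))⟩

/-- A totally real quadratic field is `ℚ(√d)` for a squarefree integer `d > 1`. -/
theorem exists_squarefree_sq_eq [IsTotallyReal K] (hK : Module.finrank ℚ K = 2) :
    ∃ (d : ℕ) (r : K), 1 < d ∧ Squarefree d ∧ r ^ 2 = d ∧ r ∉ (algebraMap ℚ K).range := by
  obtain ⟨x, hx, q, hq⟩ := exists_sq_eq_algebraMap hK
  obtain ⟨φ⟩ := exists_real_embedding (K := K)
  have hx0 : x ≠ 0 := by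
    rintro rfl
    exact hx (zero_mem _)
  have hqpos : 0 < q := by
    have h := congrArg φ hq
    rw [map_pow, eq_ratCast, map_ratCast] at h
    have : φ x ≠ 0 := by simpa using hx0
    have : (0 : ℝ) < q := by rw [← h]; positivity
    exact_mod_cast this
  obtain ⟨N, hN⟩ : ∃ N : ℕ, q.num = N := ⟨q.num.toNat, by
    have := Rat.num_pos.2 hqpos
    omega⟩
  have hNpos : 0 < N := by
    have := Rat.num_pos.2 hqpos
    omega
  -- `N / q.den` and `N * q.den` agree modulo squares, so `d` is the squarefree part of the latter.
  obtain ⟨d, m, hd, hm, hdm, hsq⟩ := Nat.sq_mul_squarefree_of_pos (n := N * q.den)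
    (Nat.mul_pos hNpos q.den_pos)
  have hmK : (m : K) ≠ 0 := by exact_mod_cast hm.ne'
  have hdenK : (q.den : K) ≠ 0 := by exact_mod_cast q.den_pos.ne'
  have hr : (q.den * x / m) ^ 2 = (d : K) := by
    have h1 : (q : K) * q.den = N := by
      have : q * q.den = N := by rw [Rat.mul_den_eq_num, hN]; simp
      exact_mod_cast congrArg (Rat.cast : ℚ → K) this
    have h2 : (m : K) ^ 2 * d = N * q.den := by exact_mod_cast congrArg (Nat.cast : ℕ → K) hdm
    rw [eq_ratCast] at hq
    field_simp
    rw [hq]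
    linear_combination (q.den : K) * h1 - h2
  have hrange : q.den * x / m ∉ (algebraMap ℚ K).range := by
    rintro ⟨t, ht⟩
    refine hx ⟨t * m / q.den, ?_⟩
    rw [map_div₀, map_mul, ht, map_natCast, map_natCast]
    field_simp
  refine ⟨d, q.den * x / m, ?_, hsq, hr, hrange⟩
  by_contra! hcon
  obtain rfl : d = 1 := by omega
  rw [Nat.cast_one, sq_eq_one_iff] at hr
  rcases hr with h | h <;> rw [h] at hrange
  · exact hrange (one_mem _)
  · exact hrange (neg_mem (one_mem _))

/-- In a residue field with three elements `ρ` is congruent to an integer `a`, so `d ≡ a² (mod 3)`.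
-/
theorem mod_three_ne_two_of_degreeOnePrimesAbove_nonempty {d : ℤ} {ρ : 𝓞 K} (hρ : ρ ^ 2 = d)
    (h : (degreeOnePrimesAbove K 3).Nonempty) : d % 3 ≠ 2 := by
  obtain ⟨P, ⟨hP, hover⟩, hdeg⟩ := h
  have h3 : Prime (3 : ℤ) := Int.prime_three
  have : (Ideal.span {((3 : ℕ) : ℤ)}).IsMaximal :=
    PrincipalIdealRing.isMaximal_of_irreducible h3.irreducible
  have : P.IsMaximal := Ideal.IsMaximal.of_liesOver_isMaximal P (Ideal.span {((3 : ℕ) : ℤ)})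
  rw [Ideal.inertiaDeg_eq_of_isMaximal (Ideal.span {((3 : ℕ) : ℤ)}) P] at hdeg
  let : Field (ℤ ⧸ Ideal.span {((3 : ℕ) : ℤ)}) := Ideal.Quotient.field _
  have hsurj := (Algebra.finrank_eq_one_iff_bijective_algebraMap.1 hdeg).2
  obtain ⟨a', ha'⟩ := hsurj (Ideal.Quotient.mk P ρ)
  obtain ⟨a, rfl⟩ := Ideal.Quotient.mk_surjective a'
  have h1 : (a : 𝓞 K) - ρ ∈ P := by
    rw [← Ideal.Quotient.eq, ← ha']
    simp
  have h2 : algebraMap ℤ (𝓞 K) (a ^ 2 - d) ∈ P := by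
    have := P.mul_mem_left (a + ρ) h1
    convert this using 1
    simp only [eq_intCast]
    push_cast
    rw [← hρ]
    ring
  rw [← Ideal.mem_of_liesOver P (Ideal.span {((3 : ℕ) : ℤ)}), Ideal.mem_span_singleton] at h2
  intro hd
  obtain ⟨k, hk⟩ := h2
  have : a % 3 = 0 ∨ a % 3 = 1 ∨ a % 3 = 2 := by omega
  have ha : a = 3 * (a / 3) + a % 3 := by omega
  generalize a / 3 = u at ha
  rcases this with h | h | h <;> rw [h] at ha <;> subst ha <;> ring_nf at hk <;> omega

/-- If `3 ∣ d`, then `(3) = (3, ρ)²`, and every ramification index above 3 is even. -/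
theorem not_three_dvd_of_oddRamifiedPrimesAbove_nonempty {d : ℤ} (hd : Squarefree d) {ρ : 𝓞 K}
    (hρ : ρ ^ 2 = d) (h : (oddRamifiedPrimesAbove K 3).Nonempty) : ¬ (3 : ℤ) ∣ d := by
  rintro ⟨m, rfl⟩
  obtain ⟨P, ⟨hP, hover⟩, hodd⟩ := h
  apply hodd
  have hmap : (Ideal.span {((3 : ℕ) : ℤ)}).map (algebraMap ℤ (𝓞 K)) =
      Ideal.span {((3 : ℤ) : 𝓞 K), ρ} ^ 2 := by
    have hcop : IsCoprime ((3 : ℤ) : 𝓞 K) (m : 𝓞 K) :=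
      (squarefree_mul_iff.1 hd).1.isCoprime.map (Int.castRingHom (𝓞 K))
    rw [Ideal.span_pair_sq_eq_of_isCoprime (by rw [hρ, Int.cast_mul]) hcop,
      Ideal.map_span, Set.image_singleton]
    simp
  have hne : (Ideal.span {((3 : ℕ) : ℤ)}).map (algebraMap ℤ (𝓞 K)) ≠ ⊥ := by
    rw [Ideal.map_span, Set.image_singleton, Ne, Ideal.span_singleton_eq_bot]
    simp
  have hP0 : P ≠ ⊥ := ne_bot_of_le_ne_bot hne (Ideal.map_le_of_le_comap (hover.over).le)
  rw [Ideal.IsDedekindDomain.ramificationIdx_eq_multiplicity (Ideal.span {((3 : ℕ) : ℤ)}) P hne,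
    hmap, FiniteMultiplicity.multiplicity_pow (Ideal.prime_of_isPrime hP0 hP)]
  · exact dvd_mul_right _ _
  · refine FiniteMultiplicity.of_prime_left (Ideal.prime_of_isPrime hP0 hP) ?_
    intro h0
    rw [hmap, h0] at hne
    simp at hne

theorem sq_ne_neg_three [IsTotallyReal K] (k : K) : k ^ 2 ≠ -3 := by
  intro hk
  obtain ⟨φ⟩ := exists_real_embedding (K := K)
  have h := congrArg φ hk
  rw [map_pow, map_neg, map_ofNat φ 3] at h
  nlinarith [sq_nonneg (φ k)]

/-- A quadratic extension of a real quadratic field `ℚ(√d)` containing `√-3` is biquadratic. -/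
theorem nonempty_biquadraticData [IsTotallyReal K] (hK : Module.finrank ℚ K = 2) {d : ℤ} {r : K}
    (hr : r ^ 2 = d) (hrange : r ∉ (algebraMap ℚ K).range) {L : Type*} [Field L] [NumberField L]
    [Algebra K L] (hKL : Module.finrank K L = 2) {s : L} (hs : s ^ 2 = -3) :
    Nonempty (BiquadraticData L d) := by
  have h3L : algebraMap K L (-3) = -3 := by
    rw [map_neg, map_ofNat (algebraMap K L) 3]
  have hs_range : s ∉ (algebraMap K L).range := by
    rintro ⟨k, hk⟩
    apply sq_ne_neg_three k
    apply (algebraMap K L).injective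
    rw [map_pow, hk, hs, h3L]
  obtain ⟨τ, hτ⟩ := exists_algEquiv_eq_neg hKL hs_range (c := -3) (by rw [hs, h3L])
  have hs0 : s ≠ 0 := by rintro rfl; exact hs_range (zero_mem _)
  have hQL : Module.finrank ℚ L = 4 := by
    rw [← Module.finrank_mul_finrank ℚ K L, hK, hKL]
  have hsQ : s ∉ (algebraMap ℚ L).range := by
    rintro ⟨q, hq⟩
    exact hs_range ⟨q, by rw [← hq]; simp⟩
  have h3Q : algebraMap ℚ L (-3) = -3 := by
    rw [map_neg, map_ofNat (algebraMap ℚ L) 3]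
  have hQF : Module.finrank ℚ (IntermediateField.adjoin ℚ {s}) = 2 :=
    finrank_adjoin_eq_two_of_sq (c := -3) (by rw [hs, h3Q]) hsQ
  set F := IntermediateField.adjoin ℚ {s}
  have hFL : Module.finrank F L = 2 := by
    have := Module.finrank_mul_finrank ℚ F L
    rw [hQF] at this
    omega
  have hsF : s ∈ F := IntermediateField.mem_adjoin_simple_self ℚ s
  -- If `r = a + bs` with rational `a` and `b`, applying `τ`, which fixes `r` and negates `s`,
  -- forces `b = 0` and makes `r` rational.
  have hrF : algebraMap K L r ∉ (algebraMap F L).range := by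
    rintro ⟨t, ht⟩
    obtain ⟨a, b, hab⟩ := exists_eq_add_mul_of_finrank_eq_two hQF (x := ⟨s, hsF⟩) (by
      rintro ⟨q, hq⟩
      exact hsQ ⟨q, congrArg (algebraMap F L) hq⟩) t
    have hab' : algebraMap K L r = a + b * s := by
      rw [← ht, hab]
      simp
    have h1 := congrArg τ hab'
    rw [AlgEquiv.commutes] at h1
    simp only [map_add, map_mul, map_ratCast, hτ] at h1
    have h2 : (b : L) = 0 := by
      have h20 : (2 : L) ≠ 0 := two_ne_zero
      apply mul_left_cancel₀ (mul_ne_zero h20 hs0)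
      linear_combination h1 - hab'
    apply hrange
    refine ⟨a, (algebraMap K L).injective ?_⟩
    rw [hab', h2]
    simp
  obtain ⟨σ, hσ⟩ := exists_algEquiv_eq_neg hFL hrF (c := (d : F)) (by
    rw [← map_pow, hr]; simp)
  refine ⟨⟨algebraMap K L r, s, σ.restrictScalars ℚ, τ.restrictScalars ℚ, ?_, hs, hσ,
    σ.commutes ⟨s, hsF⟩, τ.commutes r, hτ, fun z => ?_, hQL⟩⟩
  · rw [← map_pow, hr]; simp
  · obtain ⟨x, y, rfl⟩ := exists_eq_add_mul_of_finrank_eq_two hKL hs_range z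
    obtain ⟨a, b, rfl⟩ := exists_eq_add_mul_of_finrank_eq_two hK hrange x
    obtain ⟨c, e, rfl⟩ := exists_eq_add_mul_of_finrank_eq_two hK hrange y
    exact ⟨a, b, c, e, by simp; ring⟩

theorem finrank_adjoinSqrtNegThree [IsTotallyReal K] :
    Module.finrank K (AdjoinSqrtNegThree K) = 2 := by
  obtain ⟨s₀, hs₀⟩ := IsAlgClosed.exists_pow_nat_eq (-3 : AlgebraicClosure K) two_pos
  have hadj : AdjoinSqrtNegThree K = IntermediateField.adjoin K {s₀} := by
    apply le_antisymm
    · refine IntermediateField.adjoin_le_iff.2 fun t ht => ?_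
      have ht : t ^ 2 = s₀ ^ 2 := by rw [hs₀]; exact ht
      have hmem := IntermediateField.mem_adjoin_simple_self K s₀
      rcases sq_eq_sq_iff_eq_or_eq_neg.1 ht with rfl | rfl
      · exact hmem
      · exact neg_mem hmem
    · exact IntermediateField.adjoin_simple_le_iff.2 (IntermediateField.subset_adjoin _ _ hs₀)
  have h3 : algebraMap K (AlgebraicClosure K) (-3) = -3 := by
    rw [map_neg, map_ofNat (algebraMap K (AlgebraicClosure K)) 3]
  rw [hadj]
  refine finrank_adjoin_eq_two_of_sq (c := -3) (by rw [hs₀, h3]) ?_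
  rintro ⟨k, hk⟩
  apply sq_ne_neg_three k
  apply (algebraMap K (AlgebraicClosure K)).injective
  rw [map_pow, hk, hs₀, h3]

end RealQuadratic

theorem corollary4p2 (K : Type*) [Field K] [NumberField K] [IsTotallyReal K]
    (hK : Module.finrank ℚ K = 2) : ¬ SatisfiesAssumption K := by
  rintro ⟨hT, hV, hodd⟩
  obtain ⟨d, r, hd, hsq, hr, hrange⟩ := exists_squarefree_sq_eq hK
  have hrd : r ^ 2 = ((d : ℤ) : K) := by exact_mod_cast hr
  have hint : IsIntegral ℤ r :=
    IsIntegral.of_pow two_pos (by rw [hrd]; exact isIntegral_algebraMap (R := ℤ) (x := (d : ℤ)))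
  obtain ⟨ρ, hρ⟩ : ∃ ρ : 𝓞 K, (ρ : K) = r := ⟨⟨r, hint⟩, rfl⟩
  have hρ2 : ρ ^ 2 = ((d : ℤ) : 𝓞 K) := RingOfIntegers.ext (by simp [hρ, hr])
  have hsqZ : Squarefree (d : ℤ) := Int.squarefree_natCast.2 hsq
  obtain ⟨s, hs⟩ := exists_sq_eq_neg_three_adjoinSqrtNegThree K
  obtain ⟨D⟩ := nonempty_biquadraticData hK hrd hrange finrank_adjoinSqrtNegThree hs
  have h1 := mod_three_ne_two_of_degreeOnePrimesAbove_nonempty hρ2 hT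
  have h2 := not_three_dvd_of_oddRamifiedPrimesAbove_nonempty hsqZ hρ2 hV
  exact D.not_odd_classNumber (by exact_mod_cast hd) hsqZ (by omega) hodd
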